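/- Let $1\le m<\infty$, let $A_m=\mathbb{Z}_{\ge 0}^m$ be the set of multi-indices, and let $\Lambda=\{\lambda_\alpha\}_{\alpha\in A_m}$ be a set of weights $0<\lambda_\alpha<\infty$. Let $\mathcal M_\Lambda$ be the complex Hilbert space spanned by the orthogonal set of monomials $\{Z^\alpha\}_{\alpha\in A_m}$ with $\|Z^\alpha\|=\lambda_\alpha$. Write $e_i$ for the multi-index with $1$ in the $i$-th position and $0$ elsewhere, and assume $(*)$ $\lambda_\alpha\ge\lambda_{\alpha+e_i}$ for all $\alpha\in A_m$ and $1\le i\le m$, so that multiplication by the coordinate $z_i$, $Z_iZ^\alpha=Z^{\alpha+e_i}$, is a contraction on $\mathcal M_\Lambda$ and $\mathcal M_\Lambda$ is a Hilbert module over $\mathbb{C}[z_1,\dots,z_m]$. Assume also $(**)$ $[Z_i,Z_j^*]$ is compact for all $1\le i,j\le m$. Let $1\le k<\infty$ and let $\mathbb{C}[z_1,\dots,z_m]$ act on $\mathcal M_\Lambda\otimes\mathbb{C}^k$ through the first factor. Then for all $\alpha^1,\dots,\alpha^n\in A_m$ and $x_1,\dots,x_n\in\mathbb{C}^k$, the submodule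 $\mathcal S$ of $\mathcal M_\Lambda\otimes\mathbb{C}^k$ generated by $\{Z^{\alpha^i}\otimes x_i\}_{i=1}^n$ (the smallest closed subspace that contains these vectors and is invariant under multiplication by polynomials) is essentially reductive: every operator $T$ in the $C^*$-algebra generated by the operators of multiplication by polynomials on $\mathcal S$ (in particular each of these multiplication operators) is essentially normal, that is, $T^*T-TT^*$ is compact. -/

import Mathlib

open scoped TensorProduct

noncomputable section

/-! ### Hilbert modules -/

/-- The structure of a Hilbert module over a commutative complex algebra `A` on the Hilbert
space `H`: a unital action of `A` by bounded operators. For `ρ : HilbertModule A H`, the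
operator of module multiplication by `a` is `ρ a`. -/
abbrev HilbertModule (A H : Type*) [CommRing A] [Algebra ℂ A] [NormedAddCommGroup H]
    [InnerProductSpace ℂ H] : Type _ :=
  A →ₐ[ℂ] (H →L[ℂ] H)

namespace HilbertModule

section General

variable {A H : Type*} [CommRing A] [Algebra ℂ A] [NormedAddCommGroup H] [InnerProductSpace ℂ H]

/-- The C*-algebra generated by the module multiplications. -/
def generatedCStarAlgebra [CompleteSpace H] (ρ : HilbertModule A H) :
    StarSubalgebra ℂ (H →L[ℂ] H) :=
  (StarAlgebra.adjoin ℂ (Set.range ρ)).topologicalClosure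

/-- `T` is essentially normal: its self-commutator `T* T - T T*` is compact. -/
def IsEssentiallyNormal [CompleteSpace H] (T : H →L[ℂ] H) : Prop :=
  IsCompactOperator (ContinuousLinearMap.adjoint T * T - T * ContinuousLinearMap.adjoint T)

/-- A Hilbert module is essentially reductive if all operators in the C*-algebra generated by its
module multiplications (in particular the module multiplications themselves) are
essentially normal. -/
def IsEssentiallyReductive [CompleteSpace H] (ρ : HilbertModule A H) : Prop :=
  ∀ T ∈ generatedCStarAlgebra ρ, IsEssentiallyNormal T

theorem IsEssentiallyReductive.isEssentiallyNormal [CompleteSpace H]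
    {ρ : HilbertModule A H} (h : IsEssentiallyReductive ρ) (a : A) :
    IsEssentiallyNormal (ρ a) :=
  h _ (StarSubalgebra.le_topologicalClosure _ (StarAlgebra.subset_adjoin ℂ _ ⟨a, rfl⟩))

/-- A closed linear subspace is a (Hilbert) submodule if it is invariant under all module
multiplications. -/
def IsSubmodule (ρ : HilbertModule A H) (N : ClosedSubmodule ℂ H) : Prop :=
  ∀ a : A, ∀ x ∈ N, ρ a x ∈ N

/-- The submodule generated by a set `G`: the smallest closed submodule containing `G`. -/
def generatedSubmodule (ρ : HilbertModule A H) (G : Set H) : ClosedSubmodule ℂ H :=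
  sInf {N : ClosedSubmodule ℂ H | IsSubmodule ρ N ∧ G ⊆ (N : Set H)}

theorem isSubmodule_generatedSubmodule (ρ : HilbertModule A H) (G : Set H) :
    IsSubmodule ρ (generatedSubmodule ρ G) := by
  intro a x hx
  rw [generatedSubmodule, ClosedSubmodule.mem_sInf] at hx ⊢
  exact fun N hN => hN.1 a x (hx N hN)

theorem subset_generatedSubmodule (ρ : HilbertModule A H) (G : Set H) :
    G ⊆ (generatedSubmodule ρ G : Set H) := by
  intro x hx
  rw [SetLike.mem_coe, generatedSubmodule, ClosedSubmodule.mem_sInf]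
  exact fun N hN => hN.2 hx

instance completeSpace_toSubmodule [CompleteSpace H] (N : ClosedSubmodule ℂ H) :
    CompleteSpace N.toSubmodule :=
  N.isClosed.completeSpace_coe

/-- A submodule as a Hilbert module in its own right, by restricting the action. -/
def restrict (ρ : HilbertModule A H) (N : ClosedSubmodule ℂ H) (hN : IsSubmodule ρ N) :
    HilbertModule A N.toSubmodule :=
  AlgHom.ofLinearMap
    { toFun := fun a => (ρ a).restrict (p := N.toSubmodule) (q := N.toSubmodule)
        (fun x hx => hN a x hx)
      map_add' := fun a b => by ext x; simp
      map_smul' := fun c a => by ext x; simp }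
    (by ext x; simp)
    (fun a b => by ext x; simp)

@[simp]
theorem coe_restrict_apply (ρ : HilbertModule A H) (N : ClosedSubmodule ℂ H)
    (hN : IsSubmodule ρ N) (a : A) (x : N.toSubmodule) :
    ((restrict ρ N hN a x : N.toSubmodule) : H) = ρ a x :=
  rfl

/-- The Hilbert module `H ⊗ F`, on which `a` acts by `ρ a ⊗ 1`. -/
def tensor (ρ : HilbertModule A H) (F : Type*) [NormedAddCommGroup F]
    [InnerProductSpace ℂ F] : HilbertModule A (H ⊗[ℂ] F) :=
  AlgHom.ofLinearMap
    { toFun := fun a => (ρ a).rTensor F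
      map_add' := fun a b => by simp
      map_smul' := fun c a => by simp }
    (by simp)
    (fun a b => by simp [ContinuousLinearMap.rTensor_mul])

@[simp]
theorem tensor_apply_tmul (ρ : HilbertModule A H) (F : Type*) [NormedAddCommGroup F]
    [InnerProductSpace ℂ F] (a : A) (x : H) (y : F) :
    tensor ρ F a (x ⊗ₜ y) = ρ a x ⊗ₜ y :=
  rfl

/-- For finite-dimensional `F` the algebraic tensor product `H ⊗ F`, with its inner product
`⟪x ⊗ y, x' ⊗ y'⟫ = ⟪x, x'⟫ ⟪y, y'⟫`, is already complete. -/
instance completeSpace_tensorProduct [CompleteSpace H] (F : Type*) [NormedAddCommGroup F]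
    [InnerProductSpace ℂ F] [FiniteDimensional ℂ F] : CompleteSpace (H ⊗[ℂ] F) := by
  let b := stdOrthonormalBasis ℂ F
  let Φ : PiLp 2 (fun _ : Fin (Module.finrank ℂ F) => H) →ₗ[ℂ] H ⊗[ℂ] F :=
    { toFun := fun v => ∑ i, v i ⊗ₜ[ℂ] b i
      map_add' := fun v w => by simp [TensorProduct.add_tmul, Finset.sum_add_distrib]
      map_smul' := fun c v => by simp [TensorProduct.smul_tmul', Finset.smul_sum] }
  have hΦ : ∀ v, ‖Φ v‖ = ‖v‖ := by
    intro v
    have h2 : inner ℂ (Φ v) (Φ v) = inner ℂ v v := by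
      simp only [Φ, LinearMap.coe_mk, AddHom.coe_mk, sum_inner, inner_sum,
        TensorProduct.inner_tmul, PiLp.inner_apply]
      refine Finset.sum_congr rfl fun i _ => ?_
      rw [Finset.sum_eq_single i]
      · simp
      · intro j _ hj
        simp [b.orthonormal.2 hj]
      · simp
    have h4 : ((‖Φ v‖ : ℂ)) ^ 2 = (‖v‖ : ℂ) ^ 2 :=
      ((inner_self_eq_norm_sq_to_K (𝕜 := ℂ) (Φ v)).symm.trans h2).trans
        (inner_self_eq_norm_sq_to_K (𝕜 := ℂ) v)
    have h3 : ‖Φ v‖ ^ 2 = ‖v‖ ^ 2 := by exact_mod_cast h4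
    exact (pow_left_inj₀ (norm_nonneg _) (norm_nonneg _) two_ne_zero).1 h3
  have hsurj : Function.Surjective Φ := by
    rw [← LinearMap.range_eq_top, eq_top_iff, ← TensorProduct.span_tmul_eq_top, Submodule.span_le]
    rintro _ ⟨x, y, rfl⟩
    refine ⟨WithLp.toLp 2 fun i => b.repr y i • x, ?_⟩
    simp only [Φ, LinearMap.coe_mk, AddHom.coe_mk, TensorProduct.smul_tmul]
    rw [← TensorProduct.tmul_sum, b.sum_repr]
  let e := LinearIsometryEquiv.ofSurjective (⟨Φ, hΦ⟩ : _ →ₗᵢ[ℂ] H ⊗[ℂ] F) hsurj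
  exact (completeSpace_congr (e := e.toEquiv) e.isometry.isUniformEmbedding).1 inferInstance

end General

end HilbertModule

/-! ### Commuting weighted shifts -/

/-- A set of weights `λ_α > 0` indexed by the multi-indices `α` in `m` variables. -/
structure WeightSet (m : ℕ) where
  weight : (Fin m →₀ ℕ) → ℝ
  weight_pos : ∀ α, 0 < weight α

namespace WeightSet

variable {m : ℕ} (Λ : WeightSet m)

/-- `λ_α ≥ λ_{α + e_i}` for all `α` and `i`. -/
def IsContractive : Prop :=
  ∀ (α : Fin m →₀ ℕ) (i : Fin m), Λ.weight (α + Finsupp.single i 1) ≤ Λ.weight α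

/-- The Hilbert space `M_Λ`, realised as `ℓ²`: a sequence `f` stands for
`∑ f α • (Z^α / λ_α)`, see `monomial` for the orthogonal generators `Z^α`. -/
abbrev Space (_ : WeightSet m) : Type := lp (fun _ : Fin m →₀ ℕ => ℂ) 2

/-- The monomial `Z^α` as a vector of `M_Λ`. -/
def monomial (α : Fin m →₀ ℕ) : Λ.Space :=
  lp.single 2 α (Λ.weight α : ℂ)

theorem norm_monomial (α : Fin m →₀ ℕ) : ‖Λ.monomial α‖ = Λ.weight α := by
  rw [monomial, lp.norm_single (by norm_num)]
  simp [abs_of_pos (Λ.weight_pos α)]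

theorem inner_monomial_of_ne {α β : Fin m →₀ ℕ} (h : α ≠ β) :
    inner ℂ (Λ.monomial α) (Λ.monomial β) = 0 := by
  rw [monomial, lp.inner_single_left, monomial, lp.single_apply_ne _ _ _ h]
  simp

theorem dense_span_monomial :
    (Submodule.span ℂ (Set.range Λ.monomial)).topologicalClosure = ⊤ := by
  rw [Submodule.topologicalClosure_eq_top_iff, Submodule.eq_bot_iff]
  intro f hf
  ext α
  have h := (Submodule.mem_orthogonal _ _).1 hf (Λ.monomial α)
    (Submodule.subset_span ⟨α, rfl⟩)
  rw [monomial, lp.inner_single_left] at h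
  have hα : (Λ.weight α : ℂ) ≠ 0 := by exact_mod_cast (Λ.weight_pos α).ne'
  simpa [hα] using h

variable {Λ}

theorem IsContractive.weight_add_le (h : Λ.IsContractive) (α β : Fin m →₀ ℕ) :
    Λ.weight (α + β) ≤ Λ.weight α := by
  induction β using Finsupp.induction_linear generalizing α with
  | zero => simp
  | add f g hf hg => rw [← add_assoc]; exact (hg _).trans (hf _)
  | single i n =>
    induction n with
    | zero => simp
    | succ n ih => rw [Finsupp.single_add, ← add_assoc]; exact (h _ i).trans ih

variable (Λ) in
/-- The coordinates of `Z^β f`: in terms of the orthonormal basis `Z^α / λ_α`, multiplication by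
`Z^β` maps `Z^α / λ_α` to `(λ_{α+β} / λ_α) • (Z^{α+β} / λ_{α+β})`. -/
def mulFun (β : Fin m →₀ ℕ) (f : (Fin m →₀ ℕ) → ℂ) (α : Fin m →₀ ℕ) : ℂ :=
  open Classical in
  if β ≤ α then ((Λ.weight α / Λ.weight (α - β) : ℝ) : ℂ) * f (α - β) else 0

theorem mulFun_add_apply (β : Fin m →₀ ℕ) (f : (Fin m →₀ ℕ) → ℂ) (α : Fin m →₀ ℕ) :
    Λ.mulFun β f (α + β) = ((Λ.weight (α + β) / Λ.weight α : ℝ) : ℂ) * f α := by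
  simp [mulFun]

theorem mulFun_of_not_le {β α : Fin m →₀ ℕ} (f : (Fin m →₀ ℕ) → ℂ) (h : ¬ β ≤ α) :
    Λ.mulFun β f α = 0 := by
  simp [mulFun, h]

theorem mulFun_mulFun (β γ : Fin m →₀ ℕ) (f : (Fin m →₀ ℕ) → ℂ) :
    Λ.mulFun β (Λ.mulFun γ f) = Λ.mulFun (β + γ) f := by
  funext α
  by_cases h : β ≤ α
  · obtain ⟨δ, rfl⟩ := exists_add_of_le h
    rw [add_comm β δ, mulFun_add_apply]
    by_cases h' : γ ≤ δ
    · obtain ⟨ε, rfl⟩ := exists_add_of_le h'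
      rw [add_comm γ ε, mulFun_add_apply, add_assoc, add_comm γ β, mulFun_add_apply,
        ← mul_assoc, ← Complex.ofReal_mul]
      congr 2
      have := (Λ.weight_pos (ε + γ)).ne'
      rw [add_comm β γ, ← add_assoc]
      field_simp
    · rw [mulFun_of_not_le _ h', mulFun_of_not_le, mul_zero]
      rwa [add_comm δ β, add_le_add_iff_left]
  · rw [mulFun_of_not_le _ h, mulFun_of_not_le _ fun h' => h (le_self_add.trans h')]

theorem IsContractive.norm_mulFun_add_le (h : Λ.IsContractive) (β : Fin m →₀ ℕ)
    (f : (Fin m →₀ ℕ) → ℂ) (α : Fin m →₀ ℕ) : ‖Λ.mulFun β f (α + β)‖ ≤ ‖f α‖ := by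
  rw [mulFun_add_apply, norm_mul, Complex.norm_real, Real.norm_of_nonneg
    (div_nonneg (Λ.weight_pos _).le (Λ.weight_pos _).le)]
  exact mul_le_of_le_one_left (norm_nonneg _)
    ((div_le_one (Λ.weight_pos _)).2 (h.weight_add_le α β))

theorem norm_sq_mulFun_eq_zero (β : Fin m →₀ ℕ) (f : (Fin m →₀ ℕ) → ℂ) (α : Fin m →₀ ℕ)
    (hα : α ∉ Set.range (· + β)) : ‖Λ.mulFun β f α‖ ^ (2 : ENNReal).toReal = 0 := by
  rw [mulFun_of_not_le]
  · simp
  · intro h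
    obtain ⟨δ, rfl⟩ := exists_add_of_le h
    exact hα ⟨δ, add_comm _ _⟩

theorem IsContractive.summable_mulFun (h : Λ.IsContractive) (β : Fin m →₀ ℕ) (f : Λ.Space) :
    Summable fun α => ‖Λ.mulFun β f α‖ ^ (2 : ENNReal).toReal := by
  rw [← (add_left_injective β).summable_iff (norm_sq_mulFun_eq_zero β f)]
  refine ((lp.memℓp f).summable (by norm_num)).of_nonneg_of_le
    (fun α => Real.rpow_nonneg (norm_nonneg _) _) fun α => ?_
  exact Real.rpow_le_rpow (norm_nonneg _) (h.norm_mulFun_add_le β f α) (by norm_num)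

theorem IsContractive.tsum_mulFun_le (h : Λ.IsContractive) (β : Fin m →₀ ℕ) (f : Λ.Space) :
    ∑' α, ‖Λ.mulFun β f α‖ ^ (2 : ENNReal).toReal ≤ ∑' α, ‖f α‖ ^ (2 : ENNReal).toReal := by
  have hs := h.summable_mulFun β f
  rw [← (add_left_injective β).tsum_eq (f := fun α => ‖Λ.mulFun β f α‖ ^ (2 : ENNReal).toReal)]
  · refine Summable.tsum_le_tsum (fun α => ?_) (hs.comp_injective (add_left_injective β))
      ((lp.memℓp f).summable (by norm_num))
    exact Real.rpow_le_rpow (norm_nonneg _) (h.norm_mulFun_add_le β f α) (by norm_num)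
  · intro α hα
    by_contra hα'
    exact hα (norm_sq_mulFun_eq_zero β f α hα')

/-- Multiplication by the monomial `Z^β` as a bounded operator on `M_Λ`. -/
def monomialOp (h : Λ.IsContractive) (β : Fin m →₀ ℕ) : Λ.Space →L[ℂ] Λ.Space :=
  LinearMap.mkContinuous
    { toFun := fun f => ⟨Λ.mulFun β f, memℓp_gen (h.summable_mulFun β f)⟩
      map_add' := fun f g => by
        ext α
        change Λ.mulFun β (f + g) α = Λ.mulFun β f α + Λ.mulFun β g α
        by_cases hα : β ≤ α <;> simp [mulFun, hα, mul_add]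
      map_smul' := fun c f => by
        ext α
        change Λ.mulFun β (c • f) α = c • Λ.mulFun β f α
        by_cases hα : β ≤ α <;> simp [mulFun, hα, mul_left_comm] }
    1
    (fun f => by
      rw [one_mul, lp.norm_eq_tsum_rpow (by norm_num), lp.norm_eq_tsum_rpow (by norm_num)]
      exact Real.rpow_le_rpow (tsum_nonneg fun α => Real.rpow_nonneg (norm_nonneg _) _) (h.tsum_mulFun_le β f)
        (by norm_num))

theorem monomialOp_apply (h : Λ.IsContractive) (β : Fin m →₀ ℕ) (f : Λ.Space)
    (α : Fin m →₀ ℕ) : monomialOp h β f α = Λ.mulFun β f α :=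
  rfl

theorem monomialOp_monomial (h : Λ.IsContractive) (β α : Fin m →₀ ℕ) :
    monomialOp h β (Λ.monomial α) = Λ.monomial (α + β) := by
  ext γ
  rw [monomialOp_apply]
  by_cases hγ : β ≤ γ
  · obtain ⟨δ, rfl⟩ := exists_add_of_le hγ
    rw [add_comm β δ, mulFun_add_apply]
    by_cases hδ : δ = α
    · subst hδ
      have : (Λ.weight δ : ℂ) ≠ 0 := by exact_mod_cast (Λ.weight_pos δ).ne'
      simp [monomial, this]
    · rw [monomial, monomial, lp.single_apply_ne _ _ _ hδ, lp.single_apply_ne, mul_zero]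
      simpa using hδ
  · rw [mulFun_of_not_le _ hγ, monomial, lp.single_apply_ne]
    rintro rfl
    exact hγ le_add_self

/-- `M_Λ` as a Hilbert module over the polynomial ring. -/
def action (h : Λ.IsContractive) : HilbertModule (MvPolynomial (Fin m) ℂ) Λ.Space :=
  AddMonoidAlgebra.lift ℂ (Λ.Space →L[ℂ] Λ.Space) (Fin m →₀ ℕ)
    { toFun := fun β => monomialOp h β.toAdd
      map_one' := by
        ext f α
        simp [monomialOp_apply, mulFun, (Λ.weight_pos α).ne']
      map_mul' := fun β γ => by
        ext f α
        exact (congrFun (mulFun_mulFun β.toAdd γ.toAdd f) α).symm }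

theorem action_monomial_apply (h : Λ.IsContractive) (β α : Fin m →₀ ℕ) (c : ℂ) :
    action h (MvPolynomial.monomial β c) (Λ.monomial α) = c • Λ.monomial (α + β) := by
  rw [← monomialOp_monomial h]
  simp [action, MvPolynomial.monomial]

/-- The coordinate shift `Z_i`, the module multiplication by `z_i`. -/
def shift (h : Λ.IsContractive) (i : Fin m) : Λ.Space →L[ℂ] Λ.Space :=
  action h (MvPolynomial.X i)

theorem shift_monomial (h : Λ.IsContractive) (i : Fin m) (α : Fin m →₀ ℕ) :
    shift h i (Λ.monomial α) = Λ.monomial (α + Finsupp.single i 1) := by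
  simpa [shift, MvPolynomial.X] using action_monomial_apply h (Finsupp.single i 1) α 1

/-- All commutators `[Z_i, Z_j*]` are compact. -/
def HasCompactCommutators (h : Λ.IsContractive) : Prop :=
  ∀ i j : Fin m, IsCompactOperator
    (shift h i * ContinuousLinearMap.adjoint (shift h j) -
      ContinuousLinearMap.adjoint (shift h j) * shift h i)

end WeightSet

end

/-! Let `P` be the projection onto the submodule `S` and `R_i` the restriction of `Z_i ⊗ 1` to `S`.
Then `[R_i, R_j*]` is the compression of `[Z_i, Z_j*] ⊗ 1`, which is compact, minus the compression
of `(Z_i ⊗ 1)(1 - P)(Z_j* ⊗ 1)`. It therefore suffices that `(1 - P)(Z_j* ⊗ 1)P` is compact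
(`isCompactOperator_commutator_restrict`).

Let `Q_c` project onto the span of the monomials whose `j`-th exponent is below `c`, with `c` larger
than the `j`-th exponent of every generator. Off this slab, a vector `Z^{α^i+β} ⊗ x_i` has `β_j ≥
1`, so lowering the exponent by `Z_j*` stays inside `S`: the operator `Z_j*(1 - Q_c) ⊗ 1` preserves
`S` and contributes nothing to `(1 - P)(Z_j* ⊗ 1)P`. What remains is `Z_j* Q_c ⊗ 1`, and `Z_j* Q_c`
is compact by induction on `c`, since `Z_j* Z_j` and `Z_j Z_j*` agree modulo compacts while `Z_j*`
lowers the slab by one.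

Finally, commuting modulo compacts passes from the generators and their adjoints to the whole
C*-algebra (`topologicalClosure_adjoin_le_essentialCentralizer`). -/

section CompactOperators

open ContinuousLinearMap

/-- If `T* T` is compact then so is `T`. -/
theorem IsCompactOperator.of_adjoint_comp_self {E F : Type*} [NormedAddCommGroup E]
    [InnerProductSpace ℂ E] [CompleteSpace E] [NormedAddCommGroup F] [InnerProductSpace ℂ F]
    [CompleteSpace F] {T : E →L[ℂ] F} (h : IsCompactOperator (adjoint T ∘L T)) :
    IsCompactOperator T := by
  have h1 := (isCompactOperator_iff_isCompact_closure_image_closedBall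
    (adjoint T ∘L T).toLinearMap one_pos).1 h
  have h2 : TotallyBounded ((adjoint T ∘L T) '' Metric.closedBall 0 1) :=
    h1.totallyBounded.subset subset_closure
  refine (isCompactOperator_iff_isCompact_closure_image_closedBall T.toLinearMap one_pos).2 ?_
  refine TotallyBounded.isCompact_of_isClosed (TotallyBounded.closure ?_) isClosed_closure
  refine Metric.totallyBounded_iff.2 fun ε hε => ?_
  -- For `z = x - y` with `x`, `y` in the unit ball, `‖T z‖² = ⟪T*T z, z⟫ ≤ 2 ‖T*T z‖`. Hence an
  -- `ε²/2`-net for the image under `T*T` yields an `ε`-net for the image under `T`.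
  obtain ⟨t, hts, htf, hcover⟩ := Metric.finite_approx_of_totallyBounded h2 (ε ^ 2 / 2)
    (by positivity)
  obtain ⟨u, hu, huf, rfl⟩ := Set.exists_subset_image_finite_and.1 ⟨t, hts, htf, rfl⟩
  refine ⟨T '' u, huf.image _, ?_⟩
  rintro _ ⟨x, hx, rfl⟩
  obtain ⟨y, hy, hxy⟩ : ∃ y ∈ u, ‖adjoint T (T x) - adjoint T (T y)‖ < ε ^ 2 / 2 := by
    simpa [dist_eq_norm] using hcover ⟨x, hx, rfl⟩
  refine Set.mem_biUnion (Set.mem_image_of_mem T hy) ?_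
  have hxy2 : ‖x - y‖ ≤ 2 := by
    have hx' := mem_closedBall_zero_iff.1 hx
    have hy' := mem_closedBall_zero_iff.1 (hu hy)
    linarith [norm_sub_le x y]
  have hsq : ‖T (x - y)‖ ^ 2 < ε ^ 2 := by
    rw [apply_norm_sq_eq_inner_adjoint_left]
    calc _ ≤ ‖(adjoint T ∘L T) (x - y)‖ * ‖x - y‖ := re_inner_le_norm _ _
      _ ≤ ‖(adjoint T ∘L T) (x - y)‖ * 2 := by gcongr
      _ < ε ^ 2 := by
        have : ‖(adjoint T ∘L T) (x - y)‖ < ε ^ 2 / 2 := by simpa using hxy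
        linarith
  change dist (T x) (T y) < ε
  rw [dist_eq_norm, ← map_sub]
  exact lt_of_pow_lt_pow_left₀ 2 hε.le hsq

/-! ### Commutation modulo the compact operators -/

section Commutators

variable {H : Type*} [NormedAddCommGroup H] [InnerProductSpace ℂ H]

/-- The closed algebra of all operators that commute with every element of `Y` modulo the
compact operators. -/
def essentialCentralizer [CompleteSpace H] (Y : Set (H →L[ℂ] H)) : Subalgebra ℂ (H →L[ℂ] H) where
  carrier := {T | ∀ S ∈ Y, IsCompactOperator (T * S - S * T)}
  mul_mem' := by
    intro T T' hT hT' S hS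
    have h : T * T' * S - S * (T * T') = T * (T' * S - S * T') + (T * S - S * T) * T' := by
      noncomm_ring
    rw [h]
    exact ((hT' S hS).clm_comp T).add ((hT S hS).comp_clm T')
  add_mem' := by
    intro T T' hT hT' S hS
    have h : (T + T') * S - S * (T + T') = (T * S - S * T) + (T' * S - S * T') := by
      noncomm_ring
    rw [h]
    exact (hT S hS).add (hT' S hS)
  algebraMap_mem' := by
    intro c S _
    rw [Algebra.commutes, sub_self]
    exact isCompactOperator_zero

variable [CompleteSpace H]

theorem mem_essentialCentralizer {Y : Set (H →L[ℂ] H)} {T : H →L[ℂ] H} :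
    T ∈ essentialCentralizer Y ↔ ∀ S ∈ Y, IsCompactOperator (T * S - S * T) :=
  Iff.rfl

theorem subset_essentialCentralizer_comm {X Y : Set (H →L[ℂ] H)} :
    X ⊆ essentialCentralizer Y ↔ Y ⊆ essentialCentralizer X := by
  have key : ∀ X Y : Set (H →L[ℂ] H), X ⊆ essentialCentralizer Y →
      Y ⊆ essentialCentralizer X := fun X Y h S hS T hT => by
    rw [← neg_sub]
    exact (h hT S hS).neg
  exact ⟨key X Y, key Y X⟩

theorem isClosed_essentialCentralizer (Y : Set (H →L[ℂ] H)) :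
    IsClosed (essentialCentralizer Y : Set (H →L[ℂ] H)) := by
  have h : (essentialCentralizer Y : Set (H →L[ℂ] H)) = ⋂ S ∈ Y,
      (fun T : H →L[ℂ] H => T * S - S * T) ⁻¹' {T : H →L[ℂ] H | IsCompactOperator T} := by
    ext T
    simp [mem_essentialCentralizer]
  rw [h]
  exact isClosed_biInter fun S _ => isClosed_setOfPred_isCompactOperator.preimage (by fun_prop)

/-- If the elements of `X` commute pairwise modulo the compact operators, then so do the elements
of the closed algebra generated by `X`. -/
theorem topologicalClosure_adjoin_le_essentialCentralizer {X : Set (H →L[ℂ] H)}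
    (h : X ⊆ essentialCentralizer X) :
    (Algebra.adjoin ℂ X).topologicalClosure ≤
      essentialCentralizer ((Algebra.adjoin ℂ X).topologicalClosure : Set (H →L[ℂ] H)) := by
  have key : ∀ Y : Set (H →L[ℂ] H), X ⊆ essentialCentralizer Y →
      (Algebra.adjoin ℂ X).topologicalClosure ≤ essentialCentralizer Y := fun Y hY =>
    Subalgebra.topologicalClosure_minimal (Algebra.adjoin_le hY) (isClosed_essentialCentralizer Y)
  -- Two passes: the first closes up one argument of the commutator, symmetry swaps the roles, and
  -- the second closes up the other.
  exact key _ (subset_essentialCentralizer_comm.1 (key X h))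

end Commutators

/-! ### Compactness of `T ⊗ 1` on a finite-dimensional amplification -/

section TensorProduct

variable {E E' F : Type*} [NormedAddCommGroup E] [InnerProductSpace ℂ E]
  [NormedAddCommGroup E'] [InnerProductSpace ℂ E'] [NormedAddCommGroup F] [InnerProductSpace ℂ F]

theorem IsCompactOperator.rTensor [FiniteDimensional ℂ F] {T : E →L[ℂ] E'}
    (hT : IsCompactOperator T) : IsCompactOperator (T.rTensor F) := by
  let b := stdOrthonormalBasis ℂ F
  let p (i) : E ⊗[ℂ] F →L[ℂ] E :=
    (TensorProduct.ridIsometry ℂ E).toLinearIsometry.toContinuousLinearMap ∘L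
      (innerSL ℂ (b i)).lTensor E
  -- With `p i` the slice map taking the `b i`-coordinate, `T ⊗ 1` is a finite sum of terms
  -- factoring through `T`; finite dimension of `F` is essential.
  have h : T.rTensor F = ∑ i, (TensorProduct.mkL ℂ E' F).flip (b i) ∘L T ∘L p i := by
    refine ContinuousLinearMap.coe_injective (TensorProduct.ext' fun x y => ?_)
    have h1 : T x ⊗ₜ[ℂ] y = ∑ i, T x ⊗ₜ[ℂ] (b.repr y i • b i) := by
      rw [← TensorProduct.tmul_sum, b.sum_repr]
    simp [p, h1, b.repr_apply_apply]
  rw [h]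
  exact (compactOperator (RingHom.id ℂ) (E ⊗[ℂ] F) (E' ⊗[ℂ] F)).sum_mem fun i _ =>
    (hT.comp_clm (p i)).clm_comp ((TensorProduct.mkL ℂ E' F).flip (b i))

end TensorProduct

end CompactOperators

/-! ### Essential reductivity from generators, and restriction to submodules -/

namespace HilbertModule

open ContinuousLinearMap

variable {A H : Type*} [CommRing A] [Algebra ℂ A] [NormedAddCommGroup H] [InnerProductSpace ℂ H]
  [CompleteSpace H]

/-- A Hilbert module is essentially reductive as soon as the module multiplications by a set of
generators of the algebra commute with each other's adjoints modulo the compact operators. -/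
theorem isEssentiallyReductive_of_adjoin_eq_top {ρ : HilbertModule A H} {s : Set A}
    (hs : Algebra.adjoin ℂ s = ⊤)
    (h : ∀ a ∈ s, ∀ b ∈ s, IsCompactOperator (ρ a * adjoint (ρ b) - adjoint (ρ b) * ρ a)) :
    IsEssentiallyReductive ρ := by
  set X : Set (H →L[ℂ] H) := ρ '' s ∪ star (ρ '' s) with hX
  have hXX : X ⊆ essentialCentralizer X := by
    rintro T (⟨a, ha, rfl⟩ | ⟨a, ha, hT⟩) S (⟨b, hb, rfl⟩ | ⟨b, hb, hS⟩)
    · rw [← map_mul, mul_comm, map_mul, sub_self]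
      exact isCompactOperator_zero
    · rw [← star_star S, ← hS]
      exact h a ha b hb
    · rw [← star_star T, ← hT, ← neg_sub]
      exact (h b hb a ha).neg
    · rw [← star_star S, ← hS, ← star_star T, ← hT, ← star_mul, ← star_mul, ← map_mul, ← map_mul,
        mul_comm, sub_self]
      exact isCompactOperator_zero
  have hadj : StarAlgebra.adjoin ℂ (Set.range ρ) ≤ StarAlgebra.adjoin ℂ (ρ '' s) := by
    refine StarAlgebra.adjoin_le ?_
    have : (Algebra.adjoin ℂ s).map ρ ≤ (StarAlgebra.adjoin ℂ (ρ '' s)).toSubalgebra := by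
      rw [AlgHom.map_adjoin]
      exact Algebra.adjoin_le (StarAlgebra.subset_adjoin ℂ _)
    rintro _ ⟨a, rfl⟩
    exact this ⟨a, by rw [hs]; trivial, rfl⟩
  intro T hT
  have hT1 : T ∈ (StarAlgebra.adjoin ℂ (ρ '' s)).topologicalClosure :=
    StarSubalgebra.topologicalClosure_mono hadj hT
  have hT2 : star T ∈ (StarAlgebra.adjoin ℂ (ρ '' s)).topologicalClosure := star_mem hT1
  -- The star algebra generated by `ρ '' s` is the algebra generated by `X`, so its closure contains
  -- both `T` and `T*` and is commutative modulo compacts.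
  exact topologicalClosure_adjoin_le_essentialCentralizer hXX hT2 T hT1

/-- Compactness of the cross-commutators of a submodule `N`, with `P` the projection onto `N`, from
that of the ambient module and of the operators `(1 - P) (ρ b)* P`. -/
theorem isCompactOperator_commutator_restrict (ρ : HilbertModule A H) (N : ClosedSubmodule ℂ H)
    (hN : IsSubmodule ρ N) (a b : A)
    (h : IsCompactOperator (ρ a * adjoint (ρ b) - adjoint (ρ b) * ρ a))
    (h' : IsCompactOperator
      (N.toSubmoduleᗮ.starProjection ∘L adjoint (ρ b) ∘L N.toSubmodule.subtypeL)) :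
    IsCompactOperator (restrict ρ N hN a * adjoint (restrict ρ N hN b) -
      adjoint (restrict ρ N hN b) * restrict ρ N hN a) := by
  set ι := N.toSubmodule.subtypeL with hι
  have hcomp (c : A) : ι ∘L restrict ρ N hN c = ρ c ∘L ι := rfl
  have hid : adjoint ι ∘L ι = ContinuousLinearMap.id ℂ N.toSubmodule := by
    ext x
    simp [hι, Submodule.adjoint_subtypeL]
  have hproj : ι ∘L adjoint ι = 1 - N.toSubmoduleᗮ.starProjection := by
    ext x
    simp [hι, Submodule.adjoint_subtypeL, Submodule.starProjection_orthogonal]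
  have hadj : adjoint (restrict ρ N hN b) = adjoint ι ∘L adjoint (ρ b) ∘L ι := by
    refine ((eq_adjoint_iff _ _).2 fun x y => ?_).symm
    rw [comp_apply, comp_apply, adjoint_inner_left, adjoint_inner_left]
    rfl
  -- The product with the adjoint on the right contains `ι ι* = 1 - P^⊥` in the middle, which gives
  -- the correction term; in the other order invariance of `N` removes the projection.
  have key : restrict ρ N hN a * adjoint (restrict ρ N hN b) -
      adjoint (restrict ρ N hN b) * restrict ρ N hN a =
      adjoint ι ∘L (ρ a * adjoint (ρ b) - adjoint (ρ b) * ρ a) ∘L ι -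
      adjoint ι ∘L ρ a ∘L N.toSubmoduleᗮ.starProjection ∘L adjoint (ρ b) ∘L ι := by
    have h1 : restrict ρ N hN a = adjoint ι ∘L ρ a ∘L ι := by
      rw [← hcomp, ← comp_assoc, hid, id_comp]
    have h2 : adjoint (restrict ρ N hN b) * restrict ρ N hN a =
        adjoint ι ∘L adjoint (ρ b) ∘L ρ a ∘L ι := by
      rw [hadj, ← hcomp]
      rfl
    have h3 : restrict ρ N hN a * adjoint (restrict ρ N hN b) =
        adjoint ι ∘L ρ a ∘L (ι ∘L adjoint ι) ∘L adjoint (ρ b) ∘L ι := by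
      rw [hadj, h1]
      rfl
    rw [h2, h3, hproj]
    ext x
    simp
  rw [key]
  exact ((h.comp_clm ι).clm_comp (adjoint ι)).sub ((h'.clm_comp (ρ a)).clm_comp (adjoint ι))

end HilbertModule

/-! ### Coordinate projections on `ℓ²` -/

namespace lp

variable {ι : Type*}

/-- The projection of `ℓ²(ι)` onto the sequences supported in `s`. -/
noncomputable def indicatorCLM (s : Set ι) :
    lp (fun _ : ι => ℂ) 2 →L[ℂ] lp (fun _ : ι => ℂ) 2 :=
  have hle (f : ι → ℂ) (i : ι) : ‖s.indicator f i‖ ≤ ‖f i‖ := norm_indicator_le_norm_self f i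
  LinearMap.mkContinuous
    { toFun := fun f => ⟨s.indicator f, (lp.memℓp f).mono' (hle f)⟩
      map_add' := fun f g => Subtype.ext (Set.indicator_add s f g)
      map_smul' := fun c f => Subtype.ext (Set.indicator_const_smul s c f) }
    1
    (fun f => by
      rw [one_mul]
      exact lp.norm_mono (by norm_num) (hle f))

theorem indicatorCLM_apply (s : Set ι) (f : lp (fun _ : ι => ℂ) 2) (i : ι) :
    indicatorCLM s f i = s.indicator f i :=
  rfl

theorem adjoint_indicatorCLM (s : Set ι) :
    ContinuousLinearMap.adjoint (indicatorCLM s) = indicatorCLM s := by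
  refine ((ContinuousLinearMap.eq_adjoint_iff _ _).2 fun f g => ?_).symm
  rw [lp.inner_eq_tsum, lp.inner_eq_tsum]
  refine tsum_congr fun i => ?_
  by_cases hi : i ∈ s <;> simp [indicatorCLM_apply, hi]

end lp

/-! ### Backward shifts and compactness on slabs -/

namespace WeightSet

open ContinuousLinearMap

variable {m : ℕ} {Λ : WeightSet m}

theorem shift_apply (h : Λ.IsContractive) (i : Fin m) (f : Λ.Space) (α : Fin m →₀ ℕ) :
    shift h i f α = Λ.mulFun (Finsupp.single i 1) f α := by
  have : shift h i = monomialOp h (Finsupp.single i 1) := by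
    simp [shift, action, MvPolynomial.X, MvPolynomial.monomial]
  rw [this, monomialOp_apply]

/-- The adjoint of a coordinate shift is a weighted backward shift. -/
theorem adjoint_shift_apply (h : Λ.IsContractive) (i : Fin m) (f : Λ.Space) (α : Fin m →₀ ℕ) :
    adjoint (shift h i) f α =
      ((Λ.weight (α + Finsupp.single i 1) / Λ.weight α : ℝ) : ℂ) *
        f (α + Finsupp.single i 1) := by
  have hα : (Λ.weight α : ℂ) ≠ 0 := by exact_mod_cast (Λ.weight_pos α).ne'
  have h1 : inner ℂ (Λ.monomial α) (adjoint (shift h i) f) =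
      inner ℂ (Λ.monomial (α + Finsupp.single i 1)) f := by
    rw [adjoint_inner_right, shift_monomial]
  rw [monomial, monomial, lp.inner_single_left, lp.inner_single_left] at h1
  simp only [RCLike.inner_apply, Complex.conj_ofReal] at h1
  push_cast
  field_simp
  linear_combination h1

theorem adjoint_shift_monomial_add (h : Λ.IsContractive) (i : Fin m) (α : Fin m →₀ ℕ) :
    ∃ c : ℂ, adjoint (shift h i) (Λ.monomial (α + Finsupp.single i 1)) = c • Λ.monomial α := by
  -- One ratio is the weight of the backward shift; the other comes from renormalising `λ_{α+e_i}`
  -- to `λ_α`.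
  refine ⟨((Λ.weight (α + Finsupp.single i 1) / Λ.weight α : ℝ) : ℂ) *
    (Λ.weight (α + Finsupp.single i 1) / Λ.weight α : ℝ), ?_⟩
  ext γ
  rw [adjoint_shift_apply]
  by_cases hγ : γ = α
  · subst hγ
    have hγ : (Λ.weight γ : ℂ) ≠ 0 := by exact_mod_cast (Λ.weight_pos γ).ne'
    simp [monomial]
    field_simp
  · rw [monomial, lp.single_apply_ne _ _ _ (by simpa using hγ)]
    rw [lp.coeFn_smul, Pi.smul_apply, monomial, lp.single_apply_ne _ _ _ hγ, smul_zero, mul_zero]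

/-- The multi-indices whose `i`-th entry is less than `c`. -/
def slab (i : Fin m) (c : ℕ) : Set (Fin m →₀ ℕ) :=
  {α | α i < c}

/-- Raising the `i`-th exponent by one carries the slab of width `c` into that of width `c + 1`, and
its complement into the complement. This index change drives the induction on `c`. -/
theorem shift_comp_indicatorCLM_slab (h : Λ.IsContractive) (i : Fin m) (c : ℕ) :
    shift h i ∘L lp.indicatorCLM (slab i c) = lp.indicatorCLM (slab i (c + 1)) ∘L shift h i := by
  ext f α
  rw [comp_apply, comp_apply, shift_apply, lp.indicatorCLM_apply]
  by_cases hα : Finsupp.single i 1 ≤ α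
  · obtain ⟨δ, rfl⟩ := exists_add_of_le hα
    rw [add_comm _ δ, mulFun_add_apply, lp.indicatorCLM_apply]
    by_cases hδ : δ i < c
    · rw [Set.indicator_of_mem (by simpa [slab] using hδ),
        Set.indicator_of_mem (by simpa [slab] using hδ), shift_apply, mulFun_add_apply]
    · rw [Set.indicator_of_notMem (by simpa [slab] using hδ),
        Set.indicator_of_notMem (by simpa [slab] using hδ), mul_zero]
  · rw [mulFun_of_not_le _ hα, Set.indicator_apply_eq_zero.2]
    intro _
    rw [shift_apply, mulFun_of_not_le _ hα]

theorem indicatorCLM_slab_comp_adjoint_shift (h : Λ.IsContractive) (i : Fin m) (c : ℕ) :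
    lp.indicatorCLM (slab i c) ∘L adjoint (shift h i) =
      adjoint (shift h i) ∘L lp.indicatorCLM (slab i (c + 1)) := by
  simpa [adjoint_comp, lp.adjoint_indicatorCLM] using
    congrArg adjoint (shift_comp_indicatorCLM_slab h i c)

theorem indicatorCLM_slab_zero (i : Fin m) :
    (lp.indicatorCLM (slab i 0) : Λ.Space →L[ℂ] Λ.Space) = 0 := by
  ext f α
  simp [lp.indicatorCLM_apply, slab]

/-- If the self-commutator of `Z_i` is compact, then so is the restriction of `Z_i` to a slab
orthogonal to the `i`-th direction. -/
theorem isCompactOperator_shift_comp_indicatorCLM (h : Λ.IsContractive) (i : Fin m)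
    (hi : IsCompactOperator (shift h i * adjoint (shift h i) - adjoint (shift h i) * shift h i))
    (c : ℕ) : IsCompactOperator (shift h i ∘L lp.indicatorCLM (slab i c)) := by
  induction c with
  | zero =>
    rw [indicatorCLM_slab_zero, comp_zero]
    exact isCompactOperator_zero
  | succ c ih =>
    set Z := shift h i with hZ
    set Q : Λ.Space →L[ℂ] Λ.Space := lp.indicatorCLM (slab i (c + 1)) with hQ
    -- Swapping `Z* Z` for `Z Z*` costs a compact commutator, and `Z* Q_{c+1} = Q_c Z*` then exposes
    -- `Z Q_c`, which is compact by induction.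
    have key : adjoint Z ∘L Z ∘L Q =
        (Z ∘L lp.indicatorCLM (slab i c)) ∘L adjoint Z -
          (Z * adjoint Z - adjoint Z * Z) ∘L Q := by
      rw [comp_assoc, hZ, indicatorCLM_slab_comp_adjoint_shift]
      ext1 f
      simp [Q]
    have h1 : IsCompactOperator (adjoint Z ∘L Z ∘L Q) := by
      rw [key]
      exact (ih.comp_clm (adjoint Z)).sub (hi.comp_clm Q)
    refine IsCompactOperator.of_adjoint_comp_self ?_
    rw [adjoint_comp, comp_assoc]
    exact h1.clm_comp (adjoint Q)

/-- Since `Z* Q_{c+1} = Q_c Z*` is the adjoint of the compact operator `Z Q_c`, the criterion on `T*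
T` applies with `T = Q_c Z*`. -/
theorem isCompactOperator_adjoint_shift_comp_indicatorCLM (h : Λ.IsContractive) (i : Fin m)
    (hi : IsCompactOperator (shift h i * adjoint (shift h i) - adjoint (shift h i) * shift h i))
    (c : ℕ) : IsCompactOperator (adjoint (shift h i) ∘L lp.indicatorCLM (slab i c)) := by
  cases c with
  | zero =>
    rw [indicatorCLM_slab_zero, comp_zero]
    exact isCompactOperator_zero
  | succ c =>
    rw [← indicatorCLM_slab_comp_adjoint_shift]
    refine IsCompactOperator.of_adjoint_comp_self ?_
    have h1 := ((isCompactOperator_shift_comp_indicatorCLM h i hi c).comp_clm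
      (lp.indicatorCLM (slab i c))).comp_clm (adjoint (shift h i))
    rw [adjoint_comp, adjoint_adjoint, lp.adjoint_indicatorCLM]
    exact h1

/-! ### The submodule generated by monomial tensors -/

section Submodule

variable {F : Type*} [NormedAddCommGroup F] [InnerProductSpace ℂ F] {ι : Type*}

/-- The submodule generated by the `Z^{α i} ⊗ x i` lies in the closed linear span of the
`Z^{α i + β} ⊗ x i`. -/
theorem generatedSubmodule_tmul_le (h : Λ.IsContractive) (α : ι → Fin m →₀ ℕ) (x : ι → F) :
    ((HilbertModule.tensor (action h) F).generatedSubmodule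
      (Set.range fun i => Λ.monomial (α i) ⊗ₜ[ℂ] x i)).toSubmodule ≤
    (Submodule.span ℂ (Set.range fun p : ι × (Fin m →₀ ℕ) =>
      Λ.monomial (α p.1 + p.2) ⊗ₜ[ℂ] x p.1)).topologicalClosure := by
  set V := Submodule.span ℂ (Set.range fun p : ι × (Fin m →₀ ℕ) =>
      Λ.monomial (α p.1 + p.2) ⊗ₜ[ℂ] x p.1) with hV
  have hinv (a : MvPolynomial (Fin m) ℂ) :
      V ≤ V.comap (HilbertModule.tensor (action h) F a).toLinearMap := by
    rw [hV, Submodule.span_le, ← hV]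
    rintro _ ⟨⟨i, β⟩, rfl⟩
    change HilbertModule.tensor (action h) F a (Λ.monomial (α i + β) ⊗ₜ[ℂ] x i) ∈ V
    induction a using MvPolynomial.induction_on' with
    | monomial γ c =>
      rw [HilbertModule.tensor_apply_tmul, action_monomial_apply, ← TensorProduct.smul_tmul',
        add_assoc]
      exact V.smul_mem c (Submodule.subset_span ⟨(i, β + γ), rfl⟩)
    | add p q hp hq =>
      rw [map_add, add_apply]
      exact V.add_mem hp hq
  have hmem : (⟨V.topologicalClosure, V.isClosed_topologicalClosure⟩ : ClosedSubmodule ℂ _) ∈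
      {N : ClosedSubmodule ℂ (Λ.Space ⊗[ℂ] F) |
        HilbertModule.IsSubmodule (HilbertModule.tensor (action h) F) N ∧
          Set.range (fun i => Λ.monomial (α i) ⊗ₜ[ℂ] x i) ⊆ (N : Set _)} := by
    refine ⟨fun a v hv => ?_, ?_⟩
    · exact map_mem_closure (HilbertModule.tensor (action h) F a).continuous hv (hinv a)
    · rintro _ ⟨i, rfl⟩
      exact V.le_topologicalClosure (Submodule.subset_span ⟨(i, 0), by simp⟩)
  exact fun v hv => ClosedSubmodule.mem_sInf.1 hv _ hmem

/-- Converse to `generatedSubmodule_tmul_le`: the spanning vectors do lie in the submodule, so a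
lowered monomial is recognised as a member. -/
theorem monomial_add_tmul_mem_generatedSubmodule (h : Λ.IsContractive) (α : ι → Fin m →₀ ℕ)
    (x : ι → F) (i : ι) (β : Fin m →₀ ℕ) :
    Λ.monomial (α i + β) ⊗ₜ[ℂ] x i ∈ (HilbertModule.tensor (action h) F).generatedSubmodule
      (Set.range fun i => Λ.monomial (α i) ⊗ₜ[ℂ] x i) := by
  have h1 := HilbertModule.isSubmodule_generatedSubmodule (HilbertModule.tensor (action h) F)
    (Set.range fun i => Λ.monomial (α i) ⊗ₜ[ℂ] x i) (MvPolynomial.monomial β 1) _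
    (HilbertModule.subset_generatedSubmodule _ _ ⟨i, rfl⟩)
  simpa [action_monomial_apply] using h1

/-- Away from a slab containing all the `α i`, the adjoint of `Z_j` maps the submodule generated by
the `Z^{α i} ⊗ x i` into itself. -/
theorem adjoint_shift_rTensor_mem_generatedSubmodule (h : Λ.IsContractive)
    (α : ι → Fin m →₀ ℕ) (x : ι → F) (j : Fin m) (c : ℕ) (hc : ∀ i, α i j < c)
    {v : Λ.Space ⊗[ℂ] F}
    (hv : v ∈ (HilbertModule.tensor (action h) F).generatedSubmodule
      (Set.range fun i => Λ.monomial (α i) ⊗ₜ[ℂ] x i)) :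
    (adjoint (shift h j) - adjoint (shift h j) ∘L lp.indicatorCLM (slab j c)).rTensor F v ∈
      (HilbertModule.tensor (action h) F).generatedSubmodule
        (Set.range fun i => Λ.monomial (α i) ⊗ₜ[ℂ] x i) := by
  set S := (HilbertModule.tensor (action h) F).generatedSubmodule
      (Set.range fun i => Λ.monomial (α i) ⊗ₜ[ℂ] x i) with hS
  set B := adjoint (shift h j) - adjoint (shift h j) ∘L lp.indicatorCLM (slab j c) with hB
  have hcl : IsClosed (S.toSubmodule.comap (B.rTensor F).toLinearMap : Set (Λ.Space ⊗[ℂ] F)) :=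
    S.isClosed.preimage (B.rTensor F).continuous
  refine Submodule.topologicalClosure_minimal _ ?_ hcl (generatedSubmodule_tmul_le h α x hv)
  rw [Submodule.span_le]
  rintro _ ⟨⟨i, β⟩, rfl⟩
  change B.rTensor F (Λ.monomial (α i + β) ⊗ₜ[ℂ] x i) ∈ S
  rw [rTensor_tmul]
  by_cases hβ : (α i + β) j < c
  · have : lp.indicatorCLM (slab j c) (Λ.monomial (α i + β)) = Λ.monomial (α i + β) := by
      ext γ
      rw [lp.indicatorCLM_apply, Set.indicator_apply_eq_self]
      intro hγ
      rw [monomial, lp.single_apply_ne]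
      rintro rfl
      exact hγ hβ
    rw [hB, sub_apply, comp_apply, this, sub_self, TensorProduct.zero_tmul]
    exact S.zero_mem
  · have h0 : lp.indicatorCLM (slab j c) (Λ.monomial (α i + β)) = 0 := by
      ext γ
      rw [lp.indicatorCLM_apply]
      refine Set.indicator_apply_eq_zero.2 fun hγ => ?_
      rw [monomial, lp.single_apply_ne]
      rintro rfl
      exact hβ hγ
    -- From `α i j < c ≤ (α i + β) j` it follows that `β j ≥ 1`, so the exponent removed by the
    -- backward shift comes from `β` and not from the generator.
    have hle : Finsupp.single j 1 ≤ β := by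
      rw [Finsupp.single_le_iff]
      have := hc i
      rw [Finsupp.add_apply] at hβ
      omega
    obtain ⟨δ, rfl⟩ := exists_add_of_le hle
    obtain ⟨d, hd⟩ := adjoint_shift_monomial_add h j (α i + δ)
    rw [hB, sub_apply, comp_apply, h0, map_zero, sub_zero, add_comm (Finsupp.single j 1) δ,
      ← add_assoc, hd, ← TensorProduct.smul_tmul']
    exact S.smul_mem d (monomial_add_tmul_mem_generatedSubmodule h α x i δ)

end Submodule

end WeightSet

/-! ### The main theorem -/

open ContinuousLinearMap in
theorem mainTheorem1 (m : ℕ) (hm : 1 ≤ m) (Λ : WeightSet m)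
    (hΛ : Λ.IsContractive) (hΛ' : WeightSet.HasCompactCommutators hΛ)
    (k : ℕ) (hk : 1 ≤ k) (n : ℕ)
    (α : Fin n → (Fin m →₀ ℕ)) (x : Fin n → EuclideanSpace ℂ (Fin k)) :
    HilbertModule.IsEssentiallyReductive
      (HilbertModule.restrict
        (HilbertModule.tensor (WeightSet.action hΛ) (EuclideanSpace ℂ (Fin k)))
        (HilbertModule.generatedSubmodule
          (HilbertModule.tensor (WeightSet.action hΛ) (EuclideanSpace ℂ (Fin k)))
          (Set.range fun i : Fin n => Λ.monomial (α i) ⊗ₜ[ℂ] x i))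
        (HilbertModule.isSubmodule_generatedSubmodule _ _)) := by
  refine HilbertModule.isEssentiallyReductive_of_adjoin_eq_top
    (MvPolynomial.adjoin_range_X (R := ℂ) (σ := Fin m)) ?_
  rintro _ ⟨i, rfl⟩ _ ⟨j, rfl⟩
  have hX (l : Fin m) : HilbertModule.tensor (WeightSet.action hΛ) (EuclideanSpace ℂ (Fin k))
      (MvPolynomial.X l) = (WeightSet.shift hΛ l).rTensor _ := rfl
  refine HilbertModule.isCompactOperator_commutator_restrict _ _ _ _ _ ?_ ?_
  · rw [hX, hX, adjoint_rTensor, ← rTensor_mul, ← rTensor_mul, ← rTensor_sub]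
    exact (hΛ' i j).rTensor
  -- Finiteness of the set of generators enters here: one slab must contain all of them.
  · obtain ⟨c, hc⟩ : ∃ c, ∀ i, α i j < c :=
      ⟨Finset.univ.sup (fun i => α i j) + 1, fun i =>
        Nat.lt_succ_of_le (Finset.le_sup (f := fun i => α i j) (Finset.mem_univ i))⟩
    have hcpt := (WeightSet.isCompactOperator_adjoint_shift_comp_indicatorCLM hΛ j (hΛ' j j)
      c).rTensor (F := EuclideanSpace ℂ (Fin k))
    set N := HilbertModule.generatedSubmodule
      (HilbertModule.tensor (WeightSet.action hΛ) (EuclideanSpace ℂ (Fin k)))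
      (Set.range fun i : Fin n => Λ.monomial (α i) ⊗ₜ[ℂ] x i) with hN
    -- The two sides differ by the part of `Z_j*` off the slab, which maps `N` into itself and is
    -- killed by the projection onto the orthogonal complement.
    have key : N.toSubmoduleᗮ.starProjection ∘L adjoint (HilbertModule.tensor
        (WeightSet.action hΛ) (EuclideanSpace ℂ (Fin k)) (MvPolynomial.X j)) ∘L
          N.toSubmodule.subtypeL =
        N.toSubmoduleᗮ.starProjection ∘L (adjoint (WeightSet.shift hΛ j) ∘L
          lp.indicatorCLM (WeightSet.slab j c)).rTensor _ ∘L N.toSubmodule.subtypeL := by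
      ext1 v
      have h1 := WeightSet.adjoint_shift_rTensor_mem_generatedSubmodule hΛ α x j c hc v.2
      rw [rTensor_sub, sub_apply] at h1
      rw [hX, adjoint_rTensor, comp_apply, comp_apply, comp_apply, comp_apply, ← sub_eq_zero,
        ← map_sub, Submodule.starProjection_apply_eq_zero_iff]
      exact N.toSubmodule.le_orthogonal_orthogonal h1
    rw [key]
    exact (hcpt.comp_clm N.toSubmodule.subtypeL).clm_comp N.toSubmoduleᗮ.starProjection
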